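/- A \emph{positive linear recurrence sequence} (PLRS) is a sequence of integers $(H_n)_{n\ge 1}$ for which there are an integer $L\ge 1$ and non-negative integers $c_1,\dots,c_L$ with $c_1>0$ and $c_L>0$ such that $H_1=1$, $H_{n+1}=c_1H_n+c_2H_{n-1}+\dots+c_nH_1+1$ for $1\le n<L$, and $H_{n+1}=c_1H_n+c_2H_{n-1}+\dots+c_LH_{n+1-L}$ for all $n\ge L$. Let $(F_n)_{n\ge1}$ be the Fibonacci numbers indexed as a PLRS (with $L=2$, $c_1=c_2=1$), that is, $F_1=1$, $F_2=2$ and $F_{n+1}=F_n+F_{n-1}$ for $n\ge 2$. For a PLRS $H$ and $m\ge 1$ let $t_{H,m}(n)$ be the number of compositions (ordered sums of positive integers) of $n$ all of whose parts belong to $\{H_i : i\ge m\}$, and let $r_m(n)=t_{F,m}(n)$. \textbf{Theorem.} Let $H$ be a PLRS. Then the following are equivalent: (i) for every $m\ge 2$ the limit $\lim_{n\to\infty} t_{H,m}(n)/r_m(n)$ exists and is finite and positive; (ii) $H_m=F_m$ for all $m\ge 1$. -/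

import Mathlib

/-- `H 1, H 2, H 3, …` is a positive linear recurrence sequence. The value `H 0` plays no role:
in both sums below the index `n + 1 - i` is at least `1`. -/
def IsPLRS (H : ℕ → ℤ) : Prop :=
  ∃ (L : ℕ) (c : ℕ → ℕ), 0 < L ∧ 0 < c 1 ∧ 0 < c L ∧
    (∀ n, L ≤ n → H (n + 1) = ∑ i ∈ Finset.Icc 1 L, (c i : ℤ) * H (n + 1 - i)) ∧
    H 1 = 1 ∧
    (∀ n, 1 ≤ n → n < L →
      H (n + 1) = (∑ i ∈ Finset.Icc 1 n, (c i : ℤ) * H (n + 1 - i)) + 1)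

/-- The Fibonacci numbers indexed as a positive linear recurrence sequence
(`L = 2`, `c₁ = c₂ = 1`): the terms of index `1, 2, 3, 4, …` are `1, 2, 3, 5, …`. -/
def fibSeq (n : ℕ) : ℤ := (Nat.fib (n + 1) : ℤ)

/-- The number of compositions of `n` all of whose parts lie in `{H i : i ≥ m}`. -/
noncomputable def compCount (H : ℕ → ℤ) (m n : ℕ) : ℕ :=
  Nat.card {c : Composition n // ∀ p ∈ c.blocks, ∃ i, m ≤ i ∧ (p : ℤ) = H i}

/-!
Let `f S` be the generating function of a set `S` of positive integers. The compositions with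
parts in `S` have generating function `1 / (1 - f S)`, so counts that agree up to constant factors
have `f S x < 1` and `f T x < 1` for the same `x`. If each element of `S` exceeds its partner
in `T` by a factor `θ > 1`, then `f S x ≤ f T (x ^ θ)`, so `1 ≤ f T x` would pass from `x` to
`x ^ θ`, hence to numbers arbitrarily close to `0`, where it fails. The constant sequence `H = 1`,
for which `f {1} x = x`, is easily excluded. It remains to see that any other positive linear
recurrence sequence that is not the Fibonacci sequence `F` is eventually larger or smaller than `F`
by a constant factor.

Write `h n = H (n + 1)`. With periodic quasi-greedy digits `d` one has
`h n = 1 + ∑ i < n, d i * h (n - 1 - i)`, and `x ^ n * h n → ℓ > 0`, where `1 / x` is the growth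
rate. Only `x = 1 / φ` needs care. Summing the recurrence by parts gives
`∑ j ≤ n, tail j * (x ^ (n - j) * h (n - j)) = ∑ k ≤ n, x ^ k`, hence
`ℓ * ∑ tail j ≤ 1 / (1 - x) = φ ^ 2`. For `F` the limit is `φ ^ 2 / √5`, whereas
`∑ tail j > √5` unless the digits are `1, 0, 1, 0, …`, those of `F`; so otherwise `ℓ` is smaller.
-/

open Filter Topology Finset
open scoped ENNReal NNReal goldenRatio

/-- From index `L` on, each term of `v` is the average of the `L` preceding terms with the
weights `p`; the weight `p i` belongs to the term `i + 1` places back. -/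
structure IsAveraging (L : ℕ) (p v : ℕ → ℝ) : Prop where
  nonneg : ∀ i, 0 ≤ p i
  sum_eq_one : ∑ i ∈ range L, p i = 1
  eq_sum : ∀ n, L ≤ n → v n = ∑ i ∈ range L, p i * v (n - 1 - i)

namespace IsAveraging

variable {L : ℕ} {p v : ℕ → ℝ} {b : ℝ}

lemma pos (hv : IsAveraging L p v) : 0 < L :=
  Nat.pos_of_ne_zero fun h => by simpa [h] using hv.sum_eq_one

lemma neg (hv : IsAveraging L p v) : IsAveraging L p (-v) :=
  ⟨hv.nonneg, hv.sum_eq_one, fun n hn => by simp [hv.eq_sum n hn]⟩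

lemma sub_eq_sum (hv : IsAveraging L p v) (b : ℝ) {n : ℕ} (hn : L ≤ n) :
    v n - b = ∑ i ∈ range L, p i * (v (n - 1 - i) - b) := by
  simp only [mul_sub, sum_sub_distrib, ← sum_mul, hv.sum_eq_one, one_mul, ← hv.eq_sum n hn]

lemma le_of_forall_window (hv : IsAveraging L p v) {M : ℕ}
    (hb : ∀ n, M ≤ n → n < M + L → b ≤ v n) (n : ℕ) (hn : M ≤ n) : b ≤ v n := by
  induction n using Nat.strong_induction_on with
  | _ n ih =>
    rcases lt_or_ge n (M + L) with hlt | hge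
    · exact hb n hn hlt
    · rw [← sub_nonneg, hv.sub_eq_sum b (by omega)]
      refine sum_nonneg fun i hi => mul_nonneg (hv.nonneg i) (sub_nonneg.2 (ih _ ?_ ?_)) <;>
      · have := mem_range.1 hi
        omega

lemma first_mul_sub_le (hv : IsAveraging L p v) {n : ℕ} (hn : L ≤ n + 1)
    (hb : ∀ k, n ≤ k + L → b ≤ v k) : p 0 * (v n - b) ≤ v (n + 1) - b := by
  have hL := hv.pos
  rw [hv.sub_eq_sum b hn]
  exact single_le_sum (f := fun i => p i * (v (n + 1 - 1 - i) - b))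
    (fun i hi => mul_nonneg (hv.nonneg i) (sub_nonneg.2 (hb _ (by
      have := mem_range.1 hi
      omega)))) (mem_range.2 hL)

/-- The weight `p 0` carries a fixed share of the excess of `v M` over the lower bound `b` into
each of the next `L` terms, and these bound all later ones. -/
lemma lower_bound_improves (hv : IsAveraging L p v) {M : ℕ} (hM : L ≤ M)
    (hb : ∀ n, M ≤ n + L → b ≤ v n) (n : ℕ) (hn : M ≤ n) :
    b + p 0 ^ L * (v M - b) ≤ v n := by
  have hexcess : 0 ≤ v M - b := sub_nonneg.2 (hb M (by omega))
  have hp1 : p 0 ≤ 1 := hv.sum_eq_one ▸ single_le_sum (fun i _ => hv.nonneg i)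
    (mem_range.2 hv.pos)
  have hpow : ∀ j, p 0 ^ j * (v M - b) ≤ v (M + j) - b := by
    intro j
    induction j with
    | zero => simp
    | succ j ih =>
      calc p 0 ^ (j + 1) * (v M - b) = p 0 * (p 0 ^ j * (v M - b)) := by ring
        _ ≤ p 0 * (v (M + j) - b) := mul_le_mul_of_nonneg_left ih (hv.nonneg 0)
        _ ≤ v (M + (j + 1)) - b :=
          hv.first_mul_sub_le (by omega) fun k hk => hb k (by omega)
  refine hv.le_of_forall_window (fun k hMk hk => ?_) n hn
  obtain ⟨j, rfl⟩ := Nat.exists_eq_add_of_le hMk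
  have : p 0 ^ L * (v M - b) ≤ p 0 ^ j * (v M - b) :=
    mul_le_mul_of_nonneg_right (pow_le_pow_of_le_one (hv.nonneg 0) hp1 (by omega)) hexcess
  linarith [hpow j]

lemma exists_forall_le (hv : IsAveraging L p v) : ∃ b, ∀ n, b ≤ v n := by
  obtain ⟨b, hb⟩ := ((range L).image v).bddBelow
  refine ⟨b, fun n => hv.le_of_forall_window (M := 0) (fun k _ hk => ?_) n n.zero_le⟩
  exact hb (mem_coe.2 (mem_image_of_mem v (mem_range.2 (by omega))))

theorem tendsto_liminf (hv : IsAveraging L p v) (hp : 0 < p 0) :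
    Tendsto v atTop (𝓝 (liminf v atTop)) := by
  obtain ⟨b, hb⟩ := hv.exists_forall_le
  obtain ⟨c, hc⟩ := hv.neg.exists_forall_le
  have hbelow : IsBoundedUnder (· ≥ ·) atTop v := isBoundedUnder_of ⟨b, hb⟩
  have habove : IsBoundedUnder (· ≤ ·) atTop v := isBoundedUnder_of ⟨-c, fun n => le_neg.1 (hc n)⟩
  set ℓ := liminf v atTop
  have hq : 0 < p 0 ^ L := pow_pos hp L
  refine tendsto_order.2 ⟨fun a ha => eventually_lt_of_lt_liminf ha hbelow, fun a ha => ?_⟩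
  -- The lower bound `ℓ - δ` improves to `ℓ - δ + p 0 ^ L * (v M - (ℓ - δ))`, which stays below
  -- `ℓ + δ` because `v` returns there infinitely often.
  obtain ⟨δ, hδ, hδa⟩ : ∃ δ > 0, 2 * δ / p 0 ^ L < a - ℓ := by
    refine ⟨p 0 ^ L * (a - ℓ) / 4, by have := sub_pos.2 ha; positivity, ?_⟩
    rw [div_lt_iff₀ hq]
    nlinarith [mul_pos hq (sub_pos.2 ha)]
  obtain ⟨N, hN⟩ := eventually_atTop.1
    (eventually_lt_of_lt_liminf (sub_lt_self ℓ hδ) hbelow)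
  filter_upwards [eventually_ge_atTop (N + L)] with M hM
  obtain ⟨n, hn, hnℓ⟩ := frequently_atTop.1
    (frequently_lt_of_liminf_lt habove.isCoboundedUnder_ge (lt_add_of_pos_right ℓ hδ)) M
  have himp := hv.lower_bound_improves (b := ℓ - δ) (by omega)
    (fun k hk => (hN k (by omega)).le) n hn
  have hM' : v M - (ℓ - δ) < 2 * δ / p 0 ^ L := by
    rw [lt_div_iff₀ hq]
    linarith
  linarith

end IsAveraging

/-- The digits `c 1, …, c (L - 1), c L - 1`, repeated periodically: the quasi-greedy form of the
coefficient string of a positive linear recurrence. The subtraction never truncates, as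
`c L > 0`. -/
def quasiGreedyDigits (L : ℕ) (c : ℕ → ℕ) (i : ℕ) : ℕ :=
  c (i % L + 1) - if i % L + 1 = L then 1 else 0

section QuasiGreedy

variable {L : ℕ} {c : ℕ → ℕ}

lemma quasiGreedyDigits_periodic (L : ℕ) (c : ℕ → ℕ) :
    Function.Periodic (quasiGreedyDigits L c) L := fun i => by
  simp only [quasiGreedyDigits, Nat.add_mod_right]

lemma quasiGreedyDigits_of_lt {i : ℕ} (hi : i + 1 < L) : quasiGreedyDigits L c i = c (i + 1) := by
  simp only [quasiGreedyDigits, Nat.mod_eq_of_lt (show i < L by omega), if_neg hi.ne, Nat.sub_zero]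

lemma quasiGreedyDigits_pred_add_one (hL : 0 < L) (hc : 0 < c L) :
    quasiGreedyDigits L c (L - 1) + 1 = c L := by
  simp only [quasiGreedyDigits, Nat.mod_eq_of_lt (Nat.sub_one_lt hL.ne'), Nat.sub_add_cancel hL,
    if_true]
  omega

lemma quasiGreedyDigits_zero_pos_or_eq_zero (hc : 0 < c 1) :
    0 < quasiGreedyDigits L c 0 ∨ quasiGreedyDigits L c = 0 := by
  rcases eq_or_ne L 1 with rfl | hL
  · rcases Nat.eq_zero_or_pos (quasiGreedyDigits 1 c 0) with h0 | h0
    · exact Or.inr (funext fun i => by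
        simpa [h0] using (quasiGreedyDigits_periodic 1 c).nat_mul_eq i)
    · exact Or.inl h0
  · rcases Nat.eq_zero_or_pos L with rfl | hpos
    · exact Or.inl (by simpa [quasiGreedyDigits] using hc)
    · exact Or.inl (by rwa [quasiGreedyDigits_of_lt (by omega)])

lemma sum_Icc_one_eq_sum_range (f : ℕ → ℤ) (k : ℕ) :
    ∑ i ∈ Icc 1 k, f i = ∑ i ∈ range k, f (i + 1) := by
  rw [range_eq_Ico, ← Ico_succ_right_eq_Icc, Order.succ_eq_add_one, ← sum_Ico_add' f 0 k 1]

lemma sum_Icc_one_eq_sum_quasiGreedyDigits (hL : 0 < L) (hc : 0 < c L) (f : ℕ → ℤ) :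
    ∑ i ∈ Icc 1 L, (c i : ℤ) * f i
      = ∑ i ∈ range L, (quasiGreedyDigits L c i : ℤ) * f (i + 1) + f L := by
  obtain ⟨l, rfl⟩ := Nat.exists_eq_succ_of_ne_zero hL.ne'
  have hlast := quasiGreedyDigits_pred_add_one hL hc
  rw [Nat.succ_sub_one] at hlast
  have hinit : ∑ i ∈ range l, (c (i + 1) : ℤ) * f (i + 1)
      = ∑ i ∈ range l, (quasiGreedyDigits (l + 1) c i : ℤ) * f (i + 1) :=
    sum_congr rfl fun i hi => by
      rw [quasiGreedyDigits_of_lt (by have := mem_range.1 hi; omega)]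
  rw [sum_Icc_one_eq_sum_range, sum_range_succ, sum_range_succ, hinit, ← Nat.succ_eq_add_one,
    ← hlast]
  push_cast
  ring

end QuasiGreedy

/-- The sequence `h` satisfies `h n = 1 + ∑ i < n, d i * h (n - 1 - i)` with digits `d` of
period `L`. For a positive linear recurrence sequence `H`, shifted to `h n = H (n + 1)`, and its
quasi-greedy digits, this single formula comprises the initial conditions and the recurrence. -/
structure HasDigits (L : ℕ) (d : ℕ → ℕ) (h : ℕ → ℝ) : Prop where
  pos : 0 < L
  periodic : Function.Periodic d L
  eq_sum : ∀ n, h n = ∑ i ∈ range n, (d i : ℝ) * h (n - 1 - i) + 1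

lemma IsPLRS.exists_eq_sum_add_one {H : ℕ → ℤ} (hH : IsPLRS H) :
    ∃ (L : ℕ) (d : ℕ → ℕ), 0 < L ∧ Function.Periodic d L ∧ (0 < d 0 ∨ d = 0) ∧
      ∀ n, H (n + 1) = ∑ i ∈ range n, (d i : ℤ) * H (n - i) + 1 := by
  obtain ⟨L, c, hL, hc1, hcL, hrec, h1, hinit⟩ := hH
  refine ⟨L, quasiGreedyDigits L c, hL, quasiGreedyDigits_periodic L c,
    quasiGreedyDigits_zero_pos_or_eq_zero hc1, fun n => ?_⟩
  induction n using Nat.strong_induction_on with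
  | _ n ih =>
    rcases lt_or_ge n L with hn | hn
    · rcases Nat.eq_zero_or_pos n with rfl | hpos
      · simpa using h1
      · rw [hinit n hpos hn, sum_Icc_one_eq_sum_range]
        congr 1
        refine sum_congr rfl fun i hi => ?_
        rw [Nat.add_sub_add_right,
          quasiGreedyDigits_of_lt (by have := mem_range.1 hi; omega)]
    · obtain ⟨r, rfl⟩ := Nat.exists_eq_add_of_le hn
      have hshift : ∀ i ∈ range r, (quasiGreedyDigits L c i : ℤ) * H (r - i)
          = quasiGreedyDigits L c (L + i) * H (L + r - (L + i)) :=
        fun i _ => by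
          rw [Nat.add_sub_add_left, add_comm L i, quasiGreedyDigits_periodic L c i]
      calc H (L + r + 1)
          = ∑ i ∈ range L, (quasiGreedyDigits L c i : ℤ) * H (L + r - i) + H (r + 1) := by
            rw [hrec _ hn, sum_Icc_one_eq_sum_quasiGreedyDigits hL hcL, add_assoc L r 1,
              Nat.add_sub_cancel_left, ← add_assoc]
            simp only [Nat.add_sub_add_right]
        _ = ∑ i ∈ range (L + r), (quasiGreedyDigits L c i : ℤ) * H (L + r - i) + 1 := by
            rw [ih r (by omega), sum_range_add, sum_congr rfl hshift, ← add_assoc]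

lemma IsPLRS.exists_hasDigits {H : ℕ → ℤ} (hH : IsPLRS H) :
    ∃ L d, HasDigits L d (fun n => (H (n + 1) : ℝ)) ∧ (0 < d 0 ∨ d = 0) := by
  obtain ⟨L, d, hL, hper, hd, hsum⟩ := hH.exists_eq_sum_add_one
  refine ⟨L, d, ⟨hL, hper, fun n => ?_⟩, hd⟩
  rw [hsum n]
  push_cast
  congr 1
  refine sum_congr rfl fun i hi => ?_
  rw [show n - 1 - i + 1 = n - i by have := mem_range.1 hi; omega]

/-- The tail `1 - (d 0 * x + ⋯ + d (j - 1) * x ^ j)`: the part of `1` that the first `j` digits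
leave unrepresented in base `1 / x`. -/
def tail (d : ℕ → ℕ) (x : ℝ) (j : ℕ) : ℝ := 1 - ∑ i ∈ range j, d i * x ^ (i + 1)

section Tail

variable {d : ℕ → ℕ} {x : ℝ}

lemma tail_zero : tail d x 0 = 1 := by simp [tail]

lemma tail_succ (j : ℕ) : tail d x (j + 1) = tail d x j - d j * x ^ (j + 1) := by
  rw [tail, tail, sum_range_succ, sub_sub]

lemma tail_antitone (hx : 0 ≤ x) : Antitone (tail d x) :=
  antitone_nat_of_succ_le fun j => by
    rw [tail_succ]
    exact sub_le_self _ (by positivity)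

lemma tail_le_one (hx : 0 ≤ x) (j : ℕ) : tail d x j ≤ 1 :=
  tail_zero (d := d) (x := x) ▸ tail_antitone hx j.zero_le

end Tail

namespace HasDigits

variable {L : ℕ} {d : ℕ → ℕ} {h : ℕ → ℝ} {x : ℝ}

lemma one_le (H : HasDigits L d h) (n : ℕ) : 1 ≤ h n := by
  induction n using Nat.strong_induction_on with
  | _ n ih =>
    rw [H.eq_sum n]
    refine le_add_of_nonneg_left (sum_nonneg fun i hi => mul_nonneg (Nat.cast_nonneg _) ?_)
    exact zero_le_one.trans (ih _ (by have := mem_range.1 hi; omega))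

lemma nonneg (H : HasDigits L d h) (n : ℕ) : 0 ≤ h n := zero_le_one.trans (H.one_le n)

lemma strictMono (H : HasDigits L d h) (hd : 0 < d 0) : StrictMono h :=
  strictMono_nat_of_lt_succ fun n => by
    have hd1 : (1 : ℝ) ≤ d 0 := by exact_mod_cast hd
    calc h n ≤ d 0 * h n := le_mul_of_one_le_left (H.nonneg n) hd1
      _ ≤ ∑ i ∈ range (n + 1), (d i : ℝ) * h (n + 1 - 1 - i) :=
        single_le_sum (f := fun i => (d i : ℝ) * h (n + 1 - 1 - i))
          (fun i _ => mul_nonneg (Nat.cast_nonneg _) (H.nonneg _)) (mem_range.2 n.succ_pos)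
      _ < h (n + 1) := by
        rw [H.eq_sum (n + 1)]
        exact lt_add_one _

lemma eq_one (H : HasDigits L 0 h) (n : ℕ) : h n = 1 := by
  simpa using H.eq_sum n

lemma recurrence (H : HasDigits L d h) {n : ℕ} (hn : L ≤ n) :
    h n = ∑ i ∈ range L, (d i : ℝ) * h (n - 1 - i) + h (n - L) := by
  obtain ⟨r, rfl⟩ := Nat.exists_eq_add_of_le hn
  rw [H.eq_sum, sum_range_add, Nat.add_sub_cancel_left, H.eq_sum r, ← add_assoc]
  congr 2
  refine sum_congr rfl fun i hi => ?_
  rw [add_comm L i, H.periodic i]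
  congr 2
  have := mem_range.1 hi
  omega

lemma unique {L' : ℕ} {h' : ℕ → ℝ} (H : HasDigits L d h) (H' : HasDigits L' d h') : h = h' := by
  funext n
  induction n using Nat.strong_induction_on with
  | _ n ih =>
    rw [H.eq_sum, H'.eq_sum]
    congr 1
    refine sum_congr rfl fun i hi => ?_
    rw [ih _ (by have := mem_range.1 hi; omega)]

/-- The root is the reciprocal of the growth rate of `h`. -/
lemma exists_root (H : HasDigits L d h) : ∃ x, 0 < x ∧ x ≤ 1 ∧ tail d x L = x ^ L := by
  have hcont : Continuous fun x : ℝ => tail d x L - x ^ L := by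
    unfold tail
    fun_prop
  have hone : tail d 1 L - 1 ^ L ≤ 0 := by
    rw [one_pow]
    exact sub_nonpos.2 (tail_le_one zero_le_one L)
  have hzero : tail d 0 L - 0 ^ L = 1 := by simp [tail, H.pos.ne']
  obtain ⟨x, ⟨hx0, hx1⟩, hx⟩ := intermediate_value_Icc' zero_le_one hcont.continuousOn
    ⟨hone, hzero.symm ▸ zero_le_one⟩
  refine ⟨x, hx0.lt_of_ne ?_, hx1, sub_eq_zero.1 hx⟩
  rintro rfl
  exact one_ne_zero (hzero.symm.trans hx)

lemma isAveraging (H : HasDigits L d h) (hx : 0 < x) (hroot : tail d x L = x ^ L) :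
    IsAveraging L (fun i => d i * x ^ (i + 1) + if i = L - 1 then x ^ L else 0)
      (fun n => x ^ n * h n) where
  nonneg i := by positivity
  sum_eq_one := by
    rw [sum_add_distrib, sum_ite_eq' (range L), if_pos (mem_range.2 (Nat.sub_one_lt H.pos.ne')),
      ← hroot, tail, add_sub_cancel]
  eq_sum n hn := by
    have hpos := H.pos
    simp only [add_mul, sum_add_distrib, ite_mul, zero_mul]
    rw [sum_ite_eq' (range L), if_pos (mem_range.2 (Nat.sub_one_lt H.pos.ne')),
      H.recurrence hn, mul_add, mul_sum, show n - 1 - (L - 1) = n - L by omega, ← mul_assoc,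
      ← pow_add, Nat.add_sub_cancel' hn]
    congr 1
    refine sum_congr rfl fun i hi => ?_
    have hpow : x ^ n = x ^ (n - 1 - i) * x ^ (i + 1) := by
      rw [← pow_add, show n - 1 - i + (i + 1) = n by have := mem_range.1 hi; omega]
    rw [hpow]
    ring

lemma exists_tendsto (H : HasDigits L d h) (hd : 0 < d 0) (hx : 0 < x) (hx1 : x ≤ 1)
    (hroot : tail d x L = x ^ L) :
    ∃ ℓ, 0 < ℓ ∧ Tendsto (fun n => x ^ n * h n) atTop (𝓝 ℓ) := by
  have hv := H.isAveraging hx hroot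
  have hbound : ∀ n, x ^ L ≤ x ^ n * h n := fun n =>
    hv.le_of_forall_window (M := 0) (fun k _ hk =>
      (pow_le_pow_of_le_one hx.le hx1 (by omega)).trans
        (le_mul_of_one_le_right (by positivity) (H.one_le k))) n n.zero_le
  have ht := hv.tendsto_liminf (by positivity)
  exact ⟨_, (pow_pos hx L).trans_le (ge_of_tendsto' ht hbound), ht⟩

lemma sum_tail_mul (H : HasDigits L d h) (n : ℕ) :
    ∑ j ∈ range (n + 1), tail d x j * (x ^ (n - j) * h (n - j)) = ∑ k ∈ range (n + 1), x ^ k := by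
  induction n with
  | zero =>
    have h0 := H.eq_sum 0
    simp only [range_zero, sum_empty, zero_add] at h0
    simp [tail_zero, h0]
  | succ n ih =>
    have hscaled : x ^ (n + 1) * h (n + 1)
        = ∑ j ∈ range (n + 1), d j * x ^ (j + 1) * (x ^ (n - j) * h (n - j)) + x ^ (n + 1) := by
      rw [H.eq_sum, mul_add, mul_one, mul_sum]
      congr 1
      refine sum_congr rfl fun j hj => ?_
      rw [Nat.add_sub_cancel, ← Nat.add_sub_of_le (Nat.le_of_lt_succ (mem_range.1 hj)),
        Nat.add_sub_cancel_left]
      ring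
    rw [sum_range_succ', sum_range_succ _ (n + 1), ← ih, tail_zero, one_mul, Nat.sub_zero,
      hscaled, ← add_assoc, ← sum_add_distrib]
    congr 1
    refine sum_congr rfl fun j _ => ?_
    rw [tail_succ, Nat.add_sub_add_right]
    ring

lemma tail_add (H : HasDigits L d h) (hroot : tail d x L = x ^ L) (j : ℕ) :
    tail d x (j + L) = x ^ L * tail d x j := by
  induction j with
  | zero => rw [zero_add, hroot, tail_zero, mul_one]
  | succ j ih =>
    rw [add_right_comm, tail_succ, tail_succ, ih, H.periodic j]
    ring

lemma tail_pos (H : HasDigits L d h) (hx : 0 < x) (hroot : tail d x L = x ^ L) (j : ℕ) :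
    0 < tail d x j := by
  have hmul : ∀ k, tail d x (k * L) = (x ^ L) ^ k := by
    intro k
    induction k with
    | zero => simp [tail_zero]
    | succ k ih => rw [Nat.succ_mul, H.tail_add hroot, ih, pow_succ']
  calc 0 < (x ^ L) ^ j := by positivity
    _ = tail d x (j * L) := (hmul j).symm
    _ ≤ tail d x j := tail_antitone hx.le (Nat.le_mul_of_pos_right j H.pos)

lemma sum_tail_mul_le_of_tendsto (H : HasDigits L d h) (hx : 0 < x) (hx1 : x < 1)
    (hroot : tail d x L = x ^ L) {ℓ : ℝ} (hℓ : Tendsto (fun n => x ^ n * h n) atTop (𝓝 ℓ)) (J : ℕ) :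
    (∑ j ∈ range J, tail d x j) * ℓ ≤ (1 - x)⁻¹ := by
  have hlim : Tendsto (fun n => ∑ j ∈ range J, tail d x j * (x ^ (n - j) * h (n - j))) atTop
      (𝓝 ((∑ j ∈ range J, tail d x j) * ℓ)) := by
    rw [sum_mul]
    exact tendsto_finsetSum _ fun j _ => (hℓ.comp (tendsto_sub_atTop_nat j)).const_mul _
  refine le_of_tendsto hlim ((eventually_ge_atTop J).mono fun n hn => ?_)
  calc ∑ j ∈ range J, tail d x j * (x ^ (n - j) * h (n - j))
      ≤ ∑ j ∈ range (n + 1), tail d x j * (x ^ (n - j) * h (n - j)) :=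
        sum_le_sum_of_subset_of_nonneg (range_subset_range.2 (by omega)) fun j _ _ =>
          mul_nonneg (H.tail_pos hx hroot j).le (mul_nonneg (by positivity) (H.nonneg _))
    _ = ∑ k ∈ range (n + 1), x ^ k := H.sum_tail_mul n
    _ ≤ (1 - x)⁻¹ := by
        rw [← tsum_geometric_of_lt_one hx.le hx1]
        exact (summable_geometric_of_lt_one hx.le hx1).sum_le_tsum _ fun k _ => by positivity

end HasDigits

/-- The digits `1, 0, 1, 0, …` of the Fibonacci numbers. -/
def fibDigits (i : ℕ) : ℕ := if Even i then 1 else 0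

lemma hasDigits_fibSeq : HasDigits 2 fibDigits fun n => (fibSeq (n + 1) : ℝ) where
  pos := two_pos
  periodic i := by simp only [fibDigits, Nat.even_add, even_two, iff_true]
  eq_sum n := by
    induction n using Nat.twoStepInduction with
    | zero => simp [fibSeq]
    | one =>
      rw [sum_range_one]
      norm_num [fibSeq, fibDigits, Nat.fib_add_two]
    | more n ih _ =>
      have hfib : fibSeq (n + 2 + 1) = fibSeq (n + 1) + fibSeq (n + 2) := by
        simp only [fibSeq, Nat.fib_add_two (n := n + 2), Nat.cast_add]
      have hdigit : ∀ i, fibDigits (i + 1 + 1) = fibDigits i := fun i => by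
        simp only [fibDigits, Nat.even_add_one, not_not]
      have hidx : ∀ i, n + 2 - 1 - (i + 1 + 1) = n - 1 - i := fun i => by omega
      rw [sum_range_succ', sum_range_succ', hfib, Int.cast_add, ih]
      simp only [hdigit, hidx, show fibDigits (0 + 1) = 0 from rfl, show fibDigits 0 = 1 from rfl]
      push_cast
      ring

lemma tendsto_inv_goldenRatio_pow_mul_fibSeq :
    Tendsto (fun n => φ⁻¹ ^ n * (fibSeq (n + 1) : ℝ)) atTop (𝓝 (φ ^ 2 / √5)) := by
  have hψ : Tendsto (fun n => (φ⁻¹ * ψ) ^ n) atTop (𝓝 0) := by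
    refine tendsto_pow_atTop_nhds_zero_of_abs_lt_one ?_
    rw [Real.inv_goldenRatio, neg_mul, abs_neg, ← sq, abs_of_nonneg (sq_nonneg ψ),
      Real.goldenConj_sq]
    linarith [Real.goldenConj_neg]
  have hbinet : ∀ n, φ⁻¹ ^ n * (fibSeq (n + 1) : ℝ) = (φ ^ 2 - (φ⁻¹ * ψ) ^ n * ψ ^ 2) / √5 := by
    intro n
    rw [fibSeq, Int.cast_natCast, Real.coe_fib_eq, ← mul_div_assoc, mul_sub, add_assoc, pow_add φ,
      pow_add ψ, ← mul_assoc, ← mul_assoc, ← mul_pow, ← mul_pow,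
      inv_mul_cancel₀ Real.goldenRatio_ne_zero, one_pow, one_mul]
  simp only [hbinet]
  simpa only [zero_mul, sub_zero] using
    (tendsto_const_nhds.sub (hψ.mul_const (ψ ^ 2))).div_const (√5)

section GoldenTail

variable {d : ℕ → ℕ} {u : ℝ} {k : ℕ}

lemma tail_and_sum_tail_of_eq_fibDigits (hu : u ^ 2 + u = 1)
    (hd : ∀ i < 2 * k, d i = fibDigits i) :
    tail d u (2 * k) = u ^ (2 * k) ∧
      ∑ j ∈ range (2 * k), tail d u j = (1 + 2 * u) * (1 - u ^ (2 * k)) := by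
  induction k with
  | zero => simp [tail_zero]
  | succ k ih =>
    obtain ⟨htail, hsum⟩ := ih fun i hi => hd i (by omega)
    have heven : d (2 * k) = 1 := (hd _ (by omega)).trans (if_pos (even_two_mul k))
    have hodd : d (2 * k + 1) = 0 :=
      (hd _ (by omega)).trans (if_neg (Nat.not_even_two_mul_add_one k))
    rw [show 2 * (k + 1) = 2 * k + 1 + 1 by ring, sum_range_succ, sum_range_succ, tail_succ,
      tail_succ, hsum, htail, heven, hodd]
    push_cast
    exact ⟨by linear_combination -u ^ (2 * k) * hu,
      by linear_combination u ^ (2 * k) * (2 * u - 1) * hu⟩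

lemma digit_even_le_one (hu0 : 0 < u) (hu : u ^ 2 + u = 1) (hd : ∀ i < 2 * k, d i = fibDigits i)
    (hpos : 0 < tail d u (2 * k + 1)) : d (2 * k) ≤ 1 := by
  rw [tail_succ, (tail_and_sum_tail_of_eq_fibDigits hu hd).1] at hpos
  by_contra! hge
  have hge : (2 : ℝ) ≤ d (2 * k) := by exact_mod_cast hge
  have hlt : d (2 * k) * u < 1 := by
    rwa [pow_succ, mul_left_comm, ← mul_one_sub, mul_pos_iff_of_pos_left (pow_pos hu0 _),
      sub_pos] at hpos
  nlinarith

lemma digit_odd_eq_zero (hu0 : 0 < u) (hu : u ^ 2 + u = 1)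
    (hd : ∀ i < 2 * k + 1, d i = fibDigits i) (hpos : 0 < tail d u (2 * k + 2)) :
    d (2 * k + 1) = 0 := by
  have heven : d (2 * k) = 1 := (hd _ (by omega)).trans (if_pos (even_two_mul k))
  rw [tail_succ, tail_succ, (tail_and_sum_tail_of_eq_fibDigits hu fun i hi => hd i (by omega)).1,
    heven] at hpos
  by_contra hne
  have hge : (1 : ℝ) ≤ d (2 * k + 1) := by exact_mod_cast Nat.pos_of_ne_zero hne
  have hle : u ^ (2 * k) * (1 - u - d (2 * k + 1) * u ^ 2) ≤ 0 :=
    mul_nonpos_of_nonneg_of_nonpos (by positivity) (by nlinarith)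
  refine hpos.not_ge (le_of_eq_of_le ?_ hle)
  push_cast
  ring

lemma lt_sum_tail_of_digit_eq_zero (hu0 : 0 < u) (hu : u ^ 2 + u = 1)
    (hd : ∀ i < 2 * k, d i = fibDigits i) (hzero : d (2 * k) = 0) (hpos : ∀ j, 0 < tail d u j) :
    1 + 2 * u < ∑ j ∈ range (2 * k + 4), tail d u j := by
  obtain ⟨htail, hsum⟩ := tail_and_sum_tail_of_eq_fibDigits hu hd
  have htail1 : tail d u (2 * k + 1) = u ^ (2 * k) := by
    rw [tail_succ, htail, hzero, Nat.cast_zero, zero_mul, sub_zero]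
  have htail2 : tail d u (2 * k + 2) = u ^ (2 * k) * (1 - d (2 * k + 1) * u ^ 2) := by
    rw [tail_succ, htail1]
    ring
  have hle : d (2 * k + 1) ≤ 2 := by
    by_contra! hge
    have hge : (3 : ℝ) ≤ d (2 * k + 1) := by exact_mod_cast hge
    have hlt : d (2 * k + 1) * u ^ 2 < 1 := by
      have := hpos (2 * k + 2)
      rwa [htail2, mul_pos_iff_of_pos_left (pow_pos hu0 _), sub_pos] at this
    nlinarith
  have hle : (d (2 * k + 1) : ℝ) ≤ 2 := by exact_mod_cast hle
  calc 1 + 2 * u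
      = (1 + 2 * u) * (1 - u ^ (2 * k)) + u ^ (2 * k) + u ^ (2 * k)
          + u ^ (2 * k) * (1 - 2 * u ^ 2) := by
        rw [show u ^ 2 = 1 - u by linarith]
        ring
    _ ≤ ∑ j ∈ range (2 * k + 3), tail d u j := by
        rw [sum_range_succ, sum_range_succ, sum_range_succ, hsum, htail, htail1, htail2]
        gcongr
    _ < ∑ j ∈ range (2 * k + 4), tail d u j := by
        rw [sum_range_succ _ (2 * k + 3)]
        exact lt_add_of_pos_right _ (hpos _)

lemma eq_fibDigits_or_exists_lt_sum_tail (hu0 : 0 < u) (hu : u ^ 2 + u = 1)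
    (hpos : ∀ j, 0 < tail d u j) :
    d = fibDigits ∨ ∃ J, 1 + 2 * u < ∑ j ∈ range J, tail d u j := by
  by_contra! ⟨hne, hsum⟩
  refine hne (funext fun n => ?_)
  induction n using Nat.strong_induction_on with
  | _ n ih =>
    obtain ⟨k, rfl | rfl⟩ := Nat.even_or_odd' n
    · rw [fibDigits, if_pos (even_two_mul k)]
      refine (digit_even_le_one hu0 hu ih (hpos _)).antisymm (Nat.one_le_iff_ne_zero.2 fun h0 => ?_)
      exact (hsum _).not_gt (lt_sum_tail_of_digit_eq_zero hu0 hu ih h0 hpos)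
    · rw [fibDigits, if_neg (Nat.not_even_two_mul_add_one k)]
      exact digit_odd_eq_zero hu0 hu ih (hpos _)

end GoldenTail

section Growth

variable {v w : ℕ → ℝ} {x y κ g : ℝ}

lemma exists_one_lt_eventually_mul_le (hx : 0 < x) (hκg : κ < g)
    (hv : Tendsto (fun n => x ^ n * v n) atTop (𝓝 κ))
    (hw : Tendsto (fun n => x ^ n * w n) atTop (𝓝 g)) :
    ∃ θ > 1, ∀ᶠ n in atTop, θ * v n ≤ w n := by
  have hnear : ∀ᶠ θ in 𝓝[>] (1 : ℝ), θ * κ < g :=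
    (((continuous_mul_const κ).tendsto 1).eventually_lt_const
      (by rwa [one_mul])).filter_mono nhdsWithin_le_nhds
  obtain ⟨θ, hθκ, hθ⟩ := (hnear.and self_mem_nhdsWithin).exists
  refine ⟨θ, hθ, ((hv.const_mul θ).eventually_lt hw hθκ).mono fun n hn => ?_⟩
  rw [mul_left_comm] at hn
  exact (lt_of_mul_lt_mul_left hn (by positivity)).le

lemma tendsto_pow_mul_zero_of_lt (hy : 0 ≤ y) (hyx : y < x)
    (hv : Tendsto (fun n => x ^ n * v n) atTop (𝓝 κ)) :
    Tendsto (fun n => y ^ n * v n) atTop (𝓝 0) := by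
  have hx : 0 < x := hy.trans_lt hyx
  have hratio := tendsto_pow_atTop_nhds_zero_of_lt_one (by positivity) ((div_lt_one hx).2 hyx)
  refine (zero_mul κ ▸ hratio.mul hv).congr fun n => ?_
  rw [← mul_assoc, ← mul_pow, div_mul_cancel₀ y hx.ne']

end Growth

lemma HasDigits.eq_fibSeq_or_exists_eventually_mul_le {L : ℕ} {d : ℕ → ℕ} {h : ℕ → ℝ}
    (H : HasDigits L d h) (hd : 0 < d 0) :
    (∀ n, h n = fibSeq (n + 1)) ∨
      (∃ θ > 1, ∀ᶠ n in atTop, θ * (fibSeq (n + 1) : ℝ) ≤ h n) ∨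
      ∃ θ > 1, ∀ᶠ n in atTop, θ * h n ≤ (fibSeq (n + 1) : ℝ) := by
  have hφ : 0 < φ⁻¹ := inv_pos.2 Real.goldenRatio_pos
  have hF := tendsto_inv_goldenRatio_pow_mul_fibSeq
  have hℓF : 0 < φ ^ 2 / √5 := by have := Real.goldenRatio_pos; positivity
  obtain ⟨x, hx0, hx1, hroot⟩ := H.exists_root
  obtain ⟨ℓ, hℓ, hlim⟩ := H.exists_tendsto hd hx0 hx1 hroot
  rcases lt_trichotomy x φ⁻¹ with hlt | rfl | hgt
  · exact Or.inr (Or.inl (exists_one_lt_eventually_mul_le hx0 hℓ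
      (tendsto_pow_mul_zero_of_lt hx0.le hlt hF) hlim))
  · have hu : φ⁻¹ ^ 2 + φ⁻¹ = 1 := by
      rw [Real.inv_goldenRatio, neg_sq, Real.goldenConj_sq]
      ring
    rcases eq_fibDigits_or_exists_lt_sum_tail hφ hu (H.tail_pos hφ hroot) with rfl | ⟨J, hJ⟩
    · exact Or.inl fun n => congrFun (H.unique hasDigits_fibSeq) n
    · have hsqrt : √5 = 1 + 2 * φ⁻¹ := by
        rw [Real.inv_goldenRatio, ← Real.goldenRatio_sub_goldenConj, ← Real.one_sub_goldenRatio]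
        ring
      have hsq : (1 - φ⁻¹)⁻¹ = φ ^ 2 := by rw [← hu, add_sub_cancel_right, ← inv_pow, inv_inv]
      have hle := H.sum_tail_mul_le_of_tendsto hφ (by nlinarith) hroot hlim J
      refine Or.inr (Or.inr (exists_one_lt_eventually_mul_le hφ ?_ hlim hF))
      calc ℓ < (1 - φ⁻¹)⁻¹ / √5 := by
            rw [lt_div_iff₀ (by positivity), hsqrt]
            nlinarith
        _ = φ ^ 2 / √5 := by rw [hsq]
  · exact Or.inr (Or.inr (exists_one_lt_eventually_mul_le hφ hℓF
      (tendsto_pow_mul_zero_of_lt hφ.le hgt hlim) hF))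

section Lists

variable {α : Type*} (w : α → ℝ≥0∞)

lemma tsum_fin_prod (k : ℕ) : ∑' f : Fin k → α, ∏ i, w (f i) = (∑' a, w a) ^ k := by
  induction k with
  | zero => simp
  | succ k ih =>
    rw [← (Fin.consEquiv fun _ => α).tsum_eq,
      ENNReal.tsum_prod (f := fun a f => ∏ i, w (Fin.consEquiv (fun _ => α) (a, f) i)), pow_succ',
      ← ih, ← ENNReal.tsum_mul_right]
    refine tsum_congr fun a => ?_
    rw [← ENNReal.tsum_mul_left]
    refine tsum_congr fun f => ?_
    simp [Fin.prod_univ_succ, Fin.consEquiv]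

lemma tsum_list_prod : ∑' l : List α, (l.map w).prod = (1 - ∑' a, w a)⁻¹ := by
  rw [← ENNReal.tsum_geometric, ← List.equivSigmaTuple.symm.tsum_eq, ENNReal.tsum_sigma']
  refine tsum_congr fun k => ?_
  rw [← tsum_fin_prod]
  refine tsum_congr fun f => ?_
  simp [List.equivSigmaTuple, List.map_ofFn, List.prod_ofFn]

end Lists

/-- The number of compositions of `n` all of whose parts lie in `S`. -/
noncomputable def compositionCount (S : Set ℕ) (n : ℕ) : ℕ :=
  Nat.card {c : Composition n // ∀ p ∈ c.blocks, p ∈ S}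

/-- The generating function `∑_{p ∈ S} x ^ p` of a set of natural numbers. -/
noncomputable def partSeries (S : Set ℕ) (x : ℝ≥0) : ℝ≥0∞ := ∑' p : S, (x : ℝ≥0∞) ^ (p : ℕ)

section Compositions

variable {S T : Set ℕ}

/-- A list of positive integers is a composition of its sum. -/
def listEquivSigmaComposition (hS : 0 ∉ S) :
    List S ≃ Σ n, {c : Composition n // ∀ p ∈ c.blocks, p ∈ S} where
  toFun l := ⟨(l.map Subtype.val).sum,
    ⟨l.map Subtype.val, fun {p} hp => Nat.pos_of_ne_zero (by
      obtain ⟨q, -, rfl⟩ := List.mem_map.1 hp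
      exact fun h => hS (h ▸ q.2)), rfl⟩,
    fun p hp => by
      obtain ⟨q, -, rfl⟩ := List.mem_map.1 hp
      exact q.2⟩
  invFun c := c.2.1.blocks.attachWith (· ∈ S) c.2.2
  left_inv l := List.map_injective_iff.2 Subtype.val_injective
    (List.attachWith_map_subtype_val _)
  right_inv := by
    rintro ⟨n, ⟨⟨b, hb, rfl⟩, hc⟩⟩
    have hmap : (b.attachWith (· ∈ S) hc).map Subtype.val = b := List.attachWith_map_subtype_val _
    congr!

lemma tsum_compositionCount_mul_pow (hS : 0 ∉ S) (x : ℝ≥0) :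
    ∑' n, (compositionCount S n : ℝ≥0∞) * (x : ℝ≥0∞) ^ n = (1 - partSeries S x)⁻¹ := by
  have hprod : ∀ l : List S, (l.map fun p : S => (x : ℝ≥0∞) ^ (p : ℕ)).prod
      = (x : ℝ≥0∞) ^ (listEquivSigmaComposition hS l).1 := by
    intro l
    simp only [listEquivSigmaComposition, Equiv.coe_fn_mk]
    induction l with
    | nil => rfl
    | cons p l ih => simp only [List.map_cons, List.prod_cons, List.sum_cons, pow_add, ih]
  rw [partSeries, ← tsum_list_prod, tsum_congr hprod, (listEquivSigmaComposition hS).tsum_eq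
    (fun c : Σ n, {c : Composition n // ∀ p ∈ c.blocks, p ∈ S} => (x : ℝ≥0∞) ^ c.1),
    ENNReal.tsum_sigma']
  refine tsum_congr fun n => ?_
  simp only [compositionCount, ENNReal.tsum_const, ENat.card_eq_coe_natCard, ENat.toENNReal_coe]

lemma summable_compositionCount_mul_pow_iff (hS : 0 ∉ S) (x : ℝ≥0) :
    Summable (fun n => (compositionCount S n : ℝ) * (x : ℝ) ^ n) ↔ partSeries S x < 1 := by
  have hcoe : Summable (fun n => (compositionCount S n : ℝ) * (x : ℝ) ^ n) ↔
      Summable fun n => (compositionCount S n : ℝ≥0) * x ^ n := by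
    rw [← NNReal.summable_coe]
    push_cast
    rfl
  rw [hcoe, ← ENNReal.tsum_coe_ne_top_iff_summable]
  push_cast
  rw [tsum_compositionCount_mul_pow hS, ENNReal.inv_ne_top, Ne, tsub_eq_zero_iff_le, not_le]

lemma partSeries_lt_one_iff_of_isTheta (hS : 0 ∉ S) (hT : 0 ∉ T)
    (h : (fun n => (compositionCount S n : ℝ)) =Θ[atTop] fun n => (compositionCount T n : ℝ))
    (x : ℝ≥0) : partSeries S x < 1 ↔ partSeries T x < 1 := by
  rw [← summable_compositionCount_mul_pow_iff hS, ← summable_compositionCount_mul_pow_iff hT]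
  have hx := h.mul (Asymptotics.isTheta_refl (fun n : ℕ => (x : ℝ) ^ n) atTop)
  exact ⟨fun hs => summable_of_isBigO_nat hs hx.2, fun hs => summable_of_isBigO_nat hs hx.1⟩

lemma partSeries_le_rpow {f : S → T} (hf : Function.Injective f) {θ : ℝ}
    (hθ : ∀ p, θ * (f p : ℕ) ≤ (p : ℕ)) {x : ℝ≥0} (hx0 : 0 < x) (hx1 : x ≤ 1) :
    partSeries S x ≤ partSeries T (x ^ θ) := by
  refine (ENNReal.tsum_le_tsum fun p => ?_).trans (ENNReal.tsum_comp_le_tsum_of_injective hf _)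
  rw [← ENNReal.coe_pow, ← ENNReal.coe_pow, ENNReal.coe_le_coe, ← NNReal.rpow_natCast,
    ← NNReal.rpow_natCast, ← NNReal.rpow_mul]
  exact NNReal.rpow_le_rpow_of_exponent_ge hx0 hx1 (hθ p)

lemma partSeries_lt_one_of_lt_half (hS : 0 ∉ S) {x : ℝ≥0} (hx : x < 1 / 2) :
    partSeries S x < 1 := by
  have hpos : ∀ p : S, (p : ℕ) ≠ 0 := fun p h => hS (h ▸ p.2)
  have hinj : Function.Injective fun p : S => (p : ℕ) - 1 := fun p q hpq =>
    Subtype.ext (by have := hpos p; have := hpos q; dsimp only at hpq; omega)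
  calc partSeries S x = ∑' p : S, (x : ℝ≥0∞) ^ ((p : ℕ) - 1 + 1) :=
        tsum_congr fun p => by rw [Nat.sub_add_cancel (Nat.pos_of_ne_zero (hpos p))]
    _ ≤ ∑' n : ℕ, (x : ℝ≥0∞) ^ (n + 1) :=
        ENNReal.tsum_comp_le_tsum_of_injective hinj fun n => (x : ℝ≥0∞) ^ (n + 1)
    _ = x / (1 - x) := ENNReal.tsum_geometric_add_one _
    _ < 1 := ENNReal.div_lt_of_lt_mul <| by
        rw [one_mul, lt_tsub_iff_left]
        exact_mod_cast (add_lt_add hx hx).trans_eq (add_halves 1)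

lemma exists_one_le_partSeries (hS : S.Nontrivial) :
    ∃ x, 0 < x ∧ x < 1 ∧ 1 ≤ partSeries S x := by
  obtain ⟨p, hp, q, hq, hpq⟩ := hS
  have hnear : ∀ n : ℕ, ∀ᶠ x : ℝ≥0 in 𝓝[<] 1, 1 / 2 < x ^ n := fun n =>
    (((continuous_pow n).tendsto 1).eventually_const_lt
      (by rw [one_pow]; exact half_lt_self one_pos)).filter_mono nhdsWithin_le_nhds
  have : (𝓝[<] (1 : ℝ≥0)).NeBot := nhdsLT_neBot_of_exists_lt ⟨0, one_pos⟩
  obtain ⟨x, hxp, hxq, hx0, hx1⟩ := ((hnear p).and ((hnear q).and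
    (((eventually_gt_nhds one_pos).filter_mono nhdsWithin_le_nhds).and
      self_mem_nhdsWithin))).exists
  refine ⟨x, hx0, hx1, ?_⟩
  have hne : (⟨p, hp⟩ : S) ≠ ⟨q, hq⟩ := fun h => hpq (congrArg Subtype.val h)
  calc (1 : ℝ≥0∞) ≤ (x : ℝ≥0∞) ^ p + (x : ℝ≥0∞) ^ q := by
        exact_mod_cast (add_halves (1 : ℝ≥0)).symm.trans_le (add_le_add hxp.le hxq.le)
    _ = ∑ r ∈ ({⟨p, hp⟩, ⟨q, hq⟩} : Finset S), (x : ℝ≥0∞) ^ (r : ℕ) :=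
        (sum_pair (f := fun r : S => (x : ℝ≥0∞) ^ (r : ℕ)) hne).symm
    _ ≤ partSeries S x := ENNReal.sum_le_tsum _

/-- Otherwise `x ↦ x ^ θ` would preserve `1 ≤ partSeries T x`, but its orbits tend to `0`. -/
lemma not_isTheta_of_injective (hS : 0 ∉ S) (hT : 0 ∉ T) (hT' : T.Nontrivial) {f : S → T}
    (hf : Function.Injective f) {θ : ℝ} (hθ : 1 < θ) (hle : ∀ p, θ * (f p : ℕ) ≤ (p : ℕ)) :
    ¬ (fun n => (compositionCount S n : ℝ)) =Θ[atTop] fun n => (compositionCount T n : ℝ) := by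
  intro hΘ
  obtain ⟨x, hx0, hx1, hx⟩ := exists_one_le_partSeries hT'
  have horbit : ∀ k : ℕ, 1 ≤ partSeries T (x ^ θ ^ k) := by
    intro k
    induction k with
    | zero => simpa using hx
    | succ k ih =>
      rw [← not_lt, ← partSeries_lt_one_iff_of_isTheta hS hT hΘ, not_lt] at ih
      rw [pow_succ, NNReal.rpow_mul]
      exact ih.trans (partSeries_le_rpow hf hle (NNReal.rpow_pos hx0)
        (NNReal.rpow_le_one hx1.le (by positivity)))
  have hlim : Tendsto (fun k : ℕ => (x : ℝ) ^ θ ^ k) atTop (𝓝 0) :=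
    (tendsto_rpow_atTop_of_base_lt_one _ (neg_one_lt_zero.trans hx0) hx1).comp
      (tendsto_pow_atTop_atTop_of_one_lt hθ)
  obtain ⟨k, hk⟩ := (hlim.eventually_lt_const one_half_pos).exists
  refine (horbit k).not_gt (partSeries_lt_one_of_lt_half hT ?_)
  rw [← NNReal.coe_lt_coe]
  simpa using hk

lemma not_isTheta_singleton_one (hT : 0 ∉ T) (hT' : T.Nontrivial) :
    ¬ (fun n => (compositionCount {1} n : ℝ)) =Θ[atTop] fun n => (compositionCount T n : ℝ) := by
  intro hΘ
  obtain ⟨x, -, hx1, hx⟩ := exists_one_le_partSeries hT'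
  refine hx.not_gt ((partSeries_lt_one_iff_of_isTheta zero_ne_one hT hΘ x).1 ?_)
  rw [partSeries, tsum_singleton 1 fun p : ℕ => (x : ℝ≥0∞) ^ p, pow_one]
  exact_mod_cast hx1

lemma eventually_compositionCount_ne_zero (hS : 0 ∉ S) {p q : ℕ} (hp : p ∈ S) (hq : q ∈ S)
    (hpq : p.Coprime q) : ∀ᶠ n in atTop, compositionCount S n ≠ 0 := by
  filter_upwards [eventually_ge_atTop (p.pred * q.pred)] with n hn
  obtain ⟨b, c, hbc⟩ := Nat.exists_add_mul_eq_of_gcd_dvd_of_mul_pred_le p q n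
    (hpq.gcd_eq_one ▸ one_dvd n) hn
  have hmem : ∀ r ∈ List.replicate b p ++ List.replicate c q, r ∈ S := fun r hr =>
    (List.mem_append.1 hr).elim (fun hr => List.eq_of_mem_replicate hr ▸ hp)
      fun hr => List.eq_of_mem_replicate hr ▸ hq
  have : Nonempty {c : Composition n // ∀ p ∈ c.blocks, p ∈ S} :=
    ⟨⟨_, fun {r} hr => Nat.pos_of_ne_zero fun h => hS (h ▸ hmem r hr), by simpa using hbc⟩, hmem⟩
  exact Nat.card_pos.ne'

end Compositions

/-- The set `{H i : i ≥ m}` of admissible parts. -/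
def partSet (H : ℕ → ℤ) (m : ℕ) : Set ℕ := {p | ∃ i, m ≤ i ∧ (p : ℤ) = H i}

lemma compCount_eq_compositionCount (H : ℕ → ℤ) (m : ℕ) :
    compCount H m = compositionCount (partSet H m) := rfl

section PartSet

variable {G K : ℕ → ℤ} {m : ℕ}

lemma compCount_congr (h : ∀ i, m ≤ i → G i = K i) : compCount G m = compCount K m := by
  have hset : partSet G m = partSet K m :=
    Set.ext fun _ => exists_congr fun i => and_congr_right fun hi => by rw [h i hi]
  rw [compCount_eq_compositionCount, compCount_eq_compositionCount, hset]

lemma zero_notMem_partSet (hK : ∀ i, m ≤ i → 0 < K i) : 0 ∉ partSet K m := by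
  rintro ⟨i, hi, h⟩
  exact (hK i hi).ne h

lemma toNat_mem_partSet (hK : ∀ i, m ≤ i → 0 < K i) {i : ℕ} (hi : m ≤ i) :
    (K i).toNat ∈ partSet K m :=
  ⟨i, hi, Int.toNat_of_nonneg (hK i hi).le⟩

lemma partSet_nontrivial (hK : ∀ i, m ≤ i → 0 < K i) (hinj : Set.InjOn K (Set.Ici m)) :
    (partSet K m).Nontrivial := by
  have hm := m.le_succ
  refine ⟨_, toNat_mem_partSet hK le_rfl, _, toNat_mem_partSet hK hm, fun h => ?_⟩
  have heq : K m = K (m + 1) := by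
    rw [← Int.toNat_of_nonneg (hK m le_rfl).le, h, Int.toNat_of_nonneg (hK _ hm).le]
  exact (Nat.succ_ne_self m) (hinj (Set.mem_Ici.2 le_rfl) (Set.mem_Ici.2 hm) heq).symm

lemma not_isTheta_compCount_of_mul_le (hG : ∀ i, m ≤ i → 0 < G i) (hK : ∀ i, m ≤ i → 0 < K i)
    (hinj : Set.InjOn K (Set.Ici m)) {θ : ℝ} (hθ : 1 < θ)
    (hle : ∀ i, m ≤ i → θ * (K i : ℝ) ≤ G i) :
    ¬ (fun n => (compCount G m n : ℝ)) =Θ[atTop] fun n => (compCount K m n : ℝ) := by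
  have hmem : ∀ p : partSet G m, ∃ i, m ≤ i ∧ ((p : ℕ) : ℤ) = G i := Subtype.property
  choose index hindex heq using hmem
  let f : partSet G m → partSet K m := fun p => ⟨_, toNat_mem_partSet hK (hindex p)⟩
  have hf : ∀ p, ((f p : ℕ) : ℤ) = K (index p) := fun p =>
    Int.toNat_of_nonneg (hK _ (hindex p)).le
  refine not_isTheta_of_injective (S := partSet G m) (f := f) (zero_notMem_partSet hG)
    (zero_notMem_partSet hK) (partSet_nontrivial hK hinj) (fun p q hpq => ?_) hθ fun p => ?_
  · have hidx : index p = index q := hinj (hindex p) (hindex q) (by rw [← hf, ← hf, hpq])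
    exact Subtype.ext (Nat.cast_injective (R := ℤ) (by rw [heq, heq, hidx]))
  · calc θ * (f p : ℕ) = θ * K (index p) := by rw [← hf, Int.cast_natCast]
      _ ≤ G (index p) := hle _ (hindex p)
      _ = (p : ℕ) := by rw [← heq, Int.cast_natCast]

lemma not_isTheta_compCount_of_eq_one (hG : ∀ i, m ≤ i → G i = 1) (hK : ∀ i, m ≤ i → 0 < K i)
    (hinj : Set.InjOn K (Set.Ici m)) :
    ¬ (fun n => (compCount G m n : ℝ)) =Θ[atTop] fun n => (compCount K m n : ℝ) := by
  have hset : partSet G m = {1} := by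
    ext p
    refine ⟨fun ⟨i, hi, hp⟩ => by exact_mod_cast hp.trans (hG i hi), ?_⟩
    rintro rfl
    exact ⟨m, le_rfl, (hG m le_rfl).symm⟩
  rw [compCount_eq_compositionCount, compCount_eq_compositionCount, hset]
  exact not_isTheta_singleton_one (zero_notMem_partSet hK) (partSet_nontrivial hK hinj)

lemma not_frequently_isTheta_compCount_of_mul_le (hG : ∀ i, 1 ≤ i → 0 < G i)
    (hK : ∀ i, 1 ≤ i → 0 < K i) (hinj : Set.InjOn K (Set.Ici 1)) {θ : ℝ} (hθ : 1 < θ)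
    (hle : ∀ᶠ i in atTop, θ * (K i : ℝ) ≤ G i) :
    ¬ ∃ᶠ m in atTop,
      (fun n => (compCount G m n : ℝ)) =Θ[atTop] fun n => (compCount K m n : ℝ) := by
  obtain ⟨N, hN⟩ := eventually_atTop.1 hle
  rw [not_frequently]
  filter_upwards [eventually_ge_atTop (N + 1)] with m hm
  exact not_isTheta_compCount_of_mul_le (fun i hi => hG i (by omega)) (fun i hi => hK i (by omega))
    (hinj.mono (Set.Ici_subset_Ici.2 (by omega))) hθ fun i hi => hN i (by omega)

end PartSet

lemma eventually_of_eventually_add_one {P : ℕ → Prop} (h : ∀ᶠ n in atTop, P (n + 1)) :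
    ∀ᶠ n in atTop, P n := by
  rwa [← map_add_atTop_eq_nat 1, eventually_map]

lemma fibSeq_pos (i : ℕ) : 0 < fibSeq i := by simp [fibSeq]

lemma injOn_Ici_one {K : ℕ → ℤ} (h : Function.Injective fun n => K (n + 1)) :
    Set.InjOn K (Set.Ici 1) := by
  intro i hi j hj hij
  obtain ⟨k, rfl⟩ := Nat.exists_eq_add_of_le' hi
  obtain ⟨l, rfl⟩ := Nat.exists_eq_add_of_le' hj
  rw [h hij]

lemma fibSeq_injOn : Set.InjOn fibSeq (Set.Ici 1) :=
  injOn_Ici_one (Nat.cast_injective.comp Nat.fib_add_two_strictMono.injective)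

lemma tendsto_compCount_div_of_eq_fibSeq {H : ℕ → ℤ} {m : ℕ} (hH : ∀ i, m ≤ i → H i = fibSeq i) :
    Tendsto (fun n => (compCount H m n : ℝ) / compCount fibSeq m n) atTop (𝓝 1) := by
  have hne : ∀ᶠ n in atTop, compCount fibSeq m n ≠ 0 :=
    eventually_compositionCount_ne_zero (S := partSet fibSeq m)
      (zero_notMem_partSet fun i _ => fibSeq_pos i) ⟨m, le_rfl, rfl⟩ ⟨m + 1, m.le_succ, rfl⟩
      (Nat.fib_coprime_fib_succ (m + 1))
  rw [compCount_congr hH]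
  exact tendsto_const_nhds.congr' (hne.mono fun n hn => (div_self (Nat.cast_ne_zero.2 hn)).symm)

lemma HasDigits.eq_fibSeq_of_frequently_isTheta {L : ℕ} {d : ℕ → ℕ} {H : ℕ → ℤ}
    (hD : HasDigits L d fun n => (H (n + 1) : ℝ)) (hd : 0 < d 0)
    (hΘ : ∃ᶠ m in atTop,
      (fun n => (compCount H m n : ℝ)) =Θ[atTop] fun n => (compCount fibSeq m n : ℝ))
    {i : ℕ} (hi : 1 ≤ i) : H i = fibSeq i := by
  have hpos : ∀ i, 1 ≤ i → 0 < H i := fun i hi => by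
    obtain ⟨n, rfl⟩ := Nat.exists_eq_add_of_le' hi
    exact_mod_cast zero_lt_one.trans_le (hD.one_le n)
  have hinj : Set.InjOn H (Set.Ici 1) := injOn_Ici_one fun k l hkl =>
    (hD.strictMono hd).injective (congrArg (Int.cast : ℤ → ℝ) hkl)
  have hfib : ∀ i, 1 ≤ i → 0 < fibSeq i := fun i _ => fibSeq_pos i
  rcases hD.eq_fibSeq_or_exists_eventually_mul_le hd with heq | ⟨θ, hθ, hle⟩ | ⟨θ, hθ, hle⟩
  · obtain ⟨n, rfl⟩ := Nat.exists_eq_add_of_le' hi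
    exact_mod_cast heq n
  · exact absurd hΘ (not_frequently_isTheta_compCount_of_mul_le hpos hfib fibSeq_injOn hθ
      (eventually_of_eventually_add_one hle))
  · exact absurd (hΘ.mono fun m => Asymptotics.IsTheta.symm)
      (not_frequently_isTheta_compCount_of_mul_le hfib hpos hinj hθ
        (eventually_of_eventually_add_one hle))

theorem theorem5p2_general (H : ℕ → ℤ) (hH : IsPLRS H) :
    (∃ᶠ m in atTop,
      (fun n => (compCount H m n : ℝ)) =Θ[atTop] fun n => (compCount fibSeq m n : ℝ)) ↔
    ∀ m, 1 ≤ m → H m = fibSeq m := by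
  refine ⟨fun hΘ => ?_, fun heq => ?_⟩
  · obtain ⟨L, d, hD, hd | rfl⟩ := hH.exists_hasDigits
    · exact fun m hm => hD.eq_fibSeq_of_frequently_isTheta hd hΘ hm
    · obtain ⟨m, hm, hΘm⟩ := frequently_atTop.1 hΘ 1
      refine absurd hΘm (not_isTheta_compCount_of_eq_one (fun i hi => ?_)
        (fun i _ => fibSeq_pos i) (fibSeq_injOn.mono (Set.Ici_subset_Ici.2 hm)))
      obtain ⟨n, rfl⟩ := Nat.exists_eq_add_of_le' (hm.trans hi)
      exact_mod_cast hD.eq_one n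
  · refine ((eventually_ge_atTop 1).mono fun m hm => ?_).frequently
    rw [compCount_congr fun i hi => heq i (hm.trans hi)]

theorem theorem5p2 (H : ℕ → ℤ) (hH : IsPLRS H) :
    (∀ m : ℕ, 2 ≤ m → ∃ ℓ : ℝ, 0 < ℓ ∧
      Filter.Tendsto (fun n : ℕ => (compCount H m n : ℝ) / (compCount fibSeq m n : ℝ))
        Filter.atTop (nhds ℓ)) ↔
    ∀ m : ℕ, 1 ≤ m → H m = fibSeq m := by
  refine ⟨fun hlim => (theorem5p2_general H hH).1 ?_, fun heq m hm => ⟨1, one_pos,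
    tendsto_compCount_div_of_eq_fibSeq fun i hi => heq i (by omega)⟩⟩
  refine ((eventually_ge_atTop 2).mono fun m hm => ?_).frequently
  obtain ⟨ℓ, hℓ, ht⟩ := hlim m hm
  exact (Asymptotics.isTheta_of_div_tendsto_nhds_ne_zero ht hℓ.ne').symm
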